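/- Let $F$ be a field and let $\Omega$ be a set with two maps $s,t\colon\Omega\to\mathbb Z_{\ge 0}$. An $\Omega$-algebra is an $F$-vector space $A$ together with an $F$-linear map $\omega_A\colon A^{\otimes s(\omega)}\to A^{\otimes t(\omega)}$ for every $\omega\in\Omega$, where $A^{\otimes 0}:=F$. Coalgebras over $F$ are coassociative and counital, with $\Delta(p)=p_{(1)}\otimes p_{(2)}$ and counit $\varepsilon$. Let $\mathbf{Vect}_F(A,B)$ be the space of linear maps $A\to B$. For a coalgebra $P$ and a linear map $\psi\colon P\otimes A\to B$, put $$\psi_n(p\otimes a_1\otimes\dots\otimes a_n):=\psi(p_{(1)}\otimes a_1)\otimes\dots\otimes\psi(p_{(n)}\otimes a_n)\quad(n\ge 1),\qquad \psi_0(p):=\varepsilon(p).$$ If $A$ and $B$ are $\Omega$-algebras, $\psi$ is called a measuring from $A$ to $B$ if $$\psi_{t(\omega)}\bigl(p\otimes\omega_A(a_1\otimes\dots\otimes a_{s(\omega)})\bigr)=\omega_B\bigl(\psi_{s(\omega)}(p\otimes a_1\otimes\dots\otimes a_{s(\omega)})\bigr)$$ for all $\omega\in\Omega$, $p\in P$ and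 $a_i\in A$. The cosupport of $\psi$ is the subspace $\operatorname{cosupp}\psi:=\{\psi(p\otimes -)\mid p\in P\}\subseteq\mathbf{Vect}_F(A,B)$. Given $\Omega$-algebras $A,B$ and a subspace $V\subseteq\mathbf{Vect}_F(A,B)$, let $\mathbf{Meas}(A,B,V)$ be the category whose objects are the pairs $(P,\psi)$ of a coalgebra $P$ and a measuring $\psi\colon P\otimes A\to B$ with $\operatorname{cosupp}\psi\subseteq V$, and whose morphisms $(P_1,\psi_1)\to(P_2,\psi_2)$ are the coalgebra homomorphisms $\varphi\colon P_1\to P_2$ with $\psi_2\circ(\varphi\otimes\mathrm{id}_A)=\psi_1$. **Theorem.** For all $\Omega$-algebras $A,B$ and every subspace $V\subseteq\mathbf{Vect}_F(A,B)$, the category $\mathbf{Meas}(A,B,V)$ has a terminal object $({}_\square\mathcal C(A,B,V),\psi_{A,B,V})$ (called the $V$-universal measuring coalgebra from $A$ to $B$). -/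

import Mathlib

open scoped TensorProduct

universe w u z v₁ v₂

noncomputable section

namespace OmegaAlg

/-- For a span `Ω` with source map `s` and target map `t` into the natural numbers, an `Ω`-algebra
structure on the vector space `A`: a linear map `A^{⊗ s ω} → A^{⊗ t ω}` for each `ω : Ω`. Here
`⨂[F]^0 A` is canonically the base field `F`. -/
class OmegaAlgebra (F : Type u) [Field F] {Ω : Type z} (s t : Ω → ℕ)
    (A : Type v₁) [AddCommGroup A] [Module F A] where
  /-- The operation on `A` with the given symbol. -/
  op : ∀ ω : Ω, (⨂[F]^(s ω) A) →ₗ[F] (⨂[F]^(t ω) A)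

/-- The linear map `P ⊗ P^{⊗ n} → P^{⊗ (n+1)}`,
`p ⊗ (p₁ ⊗ ⋯ ⊗ pₙ) ↦ p ⊗ p₁ ⊗ ⋯ ⊗ pₙ`. -/
def tensorCons (F : Type u) [Field F] (P : Type w) [AddCommGroup P] [Module F P] (n : ℕ) :
    P ⊗[F] (⨂[F]^n P) →ₗ[F] (⨂[F]^(n + 1) P) :=
  TensorProduct.lift
    ((PiTensorProduct.lift (R := F) (s := fun _ : Fin n => P) (E := ⨂[F]^(n + 1) P)).toLinearMap ∘ₗ
      (PiTensorProduct.tprod F (s := fun _ : Fin (n + 1) => P)).curryLeft)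

/-- The iterated comultiplication `P → P^{⊗ n}`, `p ↦ p₍₁₎ ⊗ ⋯ ⊗ p₍ₙ₎`. For `n = 0` it is the
counit, under the canonical identification of `P^{⊗ 0}` with `F`. -/
def iterComul (F : Type u) [Field F] (P : Type w) [AddCommGroup P] [Module F P] [Coalgebra F P] :
    (n : ℕ) → P →ₗ[F] (⨂[F]^n P)
  | 0 => (PiTensorProduct.isEmptyEquiv (Fin 0)).symm.toLinearMap ∘ₗ Coalgebra.counit
  | n + 1 => tensorCons F P n ∘ₗ (iterComul F P n).lTensor P ∘ₗ Coalgebra.comul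

section Measuring

variable {F : Type u} [Field F] {P : Type w} [AddCommGroup P] [Module F P]
  {A : Type v₁} [AddCommGroup A] [Module F A] {B : Type v₂} [AddCommGroup B] [Module F B]

/-- The cosupport of `ψ : P ⊗ A → B`: the set of all maps `ψ(p ⊗ -) : A → B` with `p ∈ P`. -/
def cosupp (ψ : P ⊗[F] A →ₗ[F] B) : Submodule F (A →ₗ[F] B) :=
  LinearMap.range (TensorProduct.curry ψ)

/-- The `n`-fold tensor power of `ψ : P ⊗ A → B` for a coalgebra `P`, in curried form:
`p ↦ (a₁ ⊗ ⋯ ⊗ aₙ ↦ ψ(p₍₁₎ ⊗ a₁) ⊗ ⋯ ⊗ ψ(p₍ₙ₎ ⊗ aₙ))`. -/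
def tensorPowerMap [Coalgebra F P] (ψ : P ⊗[F] A →ₗ[F] B) (n : ℕ) :
    P →ₗ[F] (⨂[F]^n A) →ₗ[F] (⨂[F]^n B) :=
  PiTensorProduct.piTensorHomMap ∘ₗ PiTensorProduct.map (fun _ : Fin n => TensorProduct.curry ψ) ∘ₗ
    iterComul F P n

/-- `ψ : P ⊗ A → B` is a measuring from the `Ω`-algebra `A` to the `Ω`-algebra `B`: for every
`ω : Ω` and `p : P`, the tensor powers of `ψ` intertwine the operations `ω` of `A` and `B`. -/
def IsMeasuring {Ω : Type z} (s t : Ω → ℕ) [OmegaAlgebra F s t A] [OmegaAlgebra F s t B]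
    [Coalgebra F P] (ψ : P ⊗[F] A →ₗ[F] B) : Prop :=
  ∀ (ω : Ω) (p : P) (x : ⨂[F]^(s ω) A),
    tensorPowerMap ψ (t ω) p (OmegaAlgebra.op (F := F) (s := s) (t := t) ω x) =
      OmegaAlgebra.op (F := F) (s := s) (t := t) ω (tensorPowerMap ψ (s ω) p x)

end Measuring

/-- An object of the category of measurings from `A` to `B` with cosupport in `V`: a coalgebra `P`
with a measuring `ψ : P ⊗ A → B` whose cosupport is contained in `V`. -/
structure Meas {F : Type u} [Field F] {Ω : Type z} (s t : Ω → ℕ)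
    (A : Type v₁) [AddCommGroup A] [Module F A] [OmegaAlgebra F s t A]
    (B : Type v₂) [AddCommGroup B] [Module F B] [OmegaAlgebra F s t B]
    (V : Submodule F (A →ₗ[F] B)) where
  /-- The measuring coalgebra. -/
  P : CoalgCat.{w} F
  /-- The measuring. -/
  ψ : P ⊗[F] A →ₗ[F] B
  isMeasuring : IsMeasuring s t ψ
  cosupp_le : cosupp ψ ≤ V

namespace Meas

variable {F : Type u} [Field F] {Ω : Type z} {s t : Ω → ℕ}
  {A : Type v₁} [AddCommGroup A] [Module F A] [OmegaAlgebra F s t A]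
  {B : Type v₂} [AddCommGroup B] [Module F B] [OmegaAlgebra F s t B]
  {V : Submodule F (A →ₗ[F] B)}

/-- A morphism of measurings: a coalgebra homomorphism `φ` with `ψ₂ ∘ (φ ⊗ id_A) = ψ₁`. -/
@[ext]
structure Hom (X Y : Meas.{w} s t A B V) where
  /-- The underlying coalgebra homomorphism. -/
  φ : X.P →ₗc[F] Y.P
  comm : Y.ψ ∘ₗ (φ : X.P →ₗ[F] Y.P).rTensor A = X.ψ

/-- The category of measurings from `A` to `B` with cosupport in `V`. -/
instance category : CategoryTheory.Category (Meas.{w} s t A B V) where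
  Hom X Y := Hom X Y
  id X := ⟨CoalgHom.id F X.P, by ext; simp⟩
  comp {X Y Z} f g := ⟨g.φ.comp f.φ, by
    rw [← f.comm, ← g.comm]
    ext
    simp⟩

end Meas

end OmegaAlg

end

/-! Every `f : P → Hom(A, B)` on a coalgebra gives each `p` a function on words in functionals of
`Hom(A, B)`: a word goes to the value at `p` of the convolution product of its letters composed with
`f`. Let `T` be the set of functions so obtained from measurings with cosupport in `V`. It sits in
one fixed function space, so no size problem arises, and direct sums of measurings make it a
subspace. Splitting words turns the comultiplication of `P` into a decomposition of `x (a * b)`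
inside `T ⊗ T`, so `T` is a coalgebra (`Representative`) whose counit is evaluation at the empty
word. One-letter words recover a map `T → Hom(A, B)`. Each element of `T` is the image of an element
of some measuring under a compatible coalgebra map, so the measuring identity and the bound `V` pass
to `T` (`isMeasuring_of_forall_mem_span`). Since word functions are natural in coalgebra maps
(`wordEval_comp`) and those of `T` itself are the identity (`wordEval_wordFunctionsToHom`), a
morphism into `T` is determined by its source. -/

open TensorProduct Coalgebra WithConv

noncomputable section

namespace OmegaAlg

/-! ### Separating families of functionals and tensor products -/

section Separating

variable {F : Type*} [Field F] {U : Type*} [AddCommGroup U] [Module F U]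
  {N : Type*} [AddCommGroup N] [Module F N] {E : Type*} [AddCommGroup E] [Module F E]

/-- A family of functionals which separates the points of a vector space. -/
def Separating {ι : Type*} (d : ι → U →ₗ[F] F) : Prop :=
  ∀ x, (∀ i, d i x = 0) → x = 0

/-- The product of two functionals, as a functional on the tensor product. -/
def tensorFunctional (d : U →ₗ[F] F) (e : N →ₗ[F] F) : U ⊗[F] N →ₗ[F] F :=
  LinearMap.mul' F F ∘ₗ TensorProduct.map d e

@[simp]
theorem tensorFunctional_tmul (d : U →ₗ[F] F) (e : N →ₗ[F] F) (x : U) (y : N) :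
    tensorFunctional d e (x ⊗ₜ y) = d x * e y := rfl

theorem Separating.eq {ι : Type*} {d : ι → U →ₗ[F] F} (hd : Separating d) {x y : U}
    (h : ∀ i, d i x = d i y) : x = y :=
  sub_eq_zero.mp <| hd _ fun i => by rw [map_sub, h, sub_self]

theorem Separating.pi_injective {ι : Type*} {d : ι → U →ₗ[F] F} (hd : Separating d) :
    Function.Injective (LinearMap.pi d) :=
  fun _ _ h => hd.eq fun i => congrFun h i

theorem Separating.tensor {ι κ : Type*} {d : ι → U →ₗ[F] F} {e : κ → N →ₗ[F] F}
    (hd : Separating d) (he : Separating e) :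
    Separating fun i : ι × κ => tensorFunctional (d i.1) (e i.2) := by
  intro z hz
  let b := Module.Basis.ofVectorSpace F U
  obtain ⟨c, rfl⟩ := TensorProduct.eq_repr_basis_left b z
  suffices c = 0 by simp [this]
  -- Contracting the second factor with `e j` leaves a relation between basis vectors, so every `e j
  -- (c i)` vanishes.
  have key (j : κ) : (c.sum fun i n => e j n • b i) = 0 := by
    refine hd _ fun i => ?_
    have := hz (i, j)
    simp only [Finsupp.sum, map_sum, tensorFunctional_tmul] at this
    simpa only [Finsupp.sum, map_sum, map_smul, smul_eq_mul, mul_comm] using this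
  ext i
  refine he _ fun j => ?_
  by_cases hi : i ∈ c.support
  · exact linearIndependent_iff'.mp b.linearIndependent c.support (fun i => e j (c i)) (key j) i hi
  · simp [Finsupp.notMem_support_iff.mp hi]

/-- A linear map factors through an injective one as soon as it does so pointwise. -/
theorem exists_comp_eq_of_injective {j : U →ₗ[F] E} (hj : Function.Injective j) (g : N →ₗ[F] E)
    (h : ∀ x, ∃ y, j y = g x) : ∃ k : N →ₗ[F] U, ∀ x, j (k x) = g x := by
  obtain ⟨r, hr⟩ := LinearMap.exists_leftInverse_of_injective j (LinearMap.ker_eq_bot.mpr hj)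
  refine ⟨r ∘ₗ g, fun x => ?_⟩
  obtain ⟨y, hy⟩ := h x
  rw [LinearMap.comp_apply, ← hy, ← LinearMap.comp_apply r j, hr, LinearMap.id_apply]

theorem separating_id_dual : Separating fun φ : Module.Dual F U => φ :=
  fun x h => (Module.forall_dual_apply_eq_zero_iff F x).mp h

end Separating

/-! ### Representative functions on a monoid form a coalgebra -/

section Representative

variable {F : Type*} [Field F] {M : Type*} (T : Submodule F (M → F))

/-- Evaluation of the functions in a function space. -/
def evalAt (m : M) : T →ₗ[F] F := LinearMap.proj m ∘ₗ T.subtype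

@[simp]
theorem evalAt_apply (m : M) (x : T) : evalAt T m x = (x : M → F) m := rfl

theorem separating_evalAt : Separating (evalAt T) :=
  fun _ h => Subtype.ext (funext fun m => h m)

variable [Monoid M]

/-- A space of functions on a monoid is representative if each `(a, b) ↦ x (a * b)` is a sum of
products of functions of the space. -/
def Representative : Prop :=
  ∀ x : T, ∃ z : T ⊗[F] T, ∀ a b, tensorFunctional (evalAt T a) (evalAt T b) z = x.1 (a * b)

variable {T}

theorem Representative.exists_comul (h : Representative T) : ∃ Δ : T →ₗ[F] T ⊗[F] T,
    ∀ x a b, tensorFunctional (evalAt T a) (evalAt T b) (Δ x) = x.1 (a * b) := by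
  let j : T ⊗[F] T →ₗ[F] M × M → F :=
    LinearMap.pi fun i => tensorFunctional (evalAt T i.1) (evalAt T i.2)
  have hj : Function.Injective j :=
    ((separating_evalAt T).tensor (separating_evalAt T)).pi_injective
  let g : T →ₗ[F] M × M → F := LinearMap.pi fun i => evalAt T (i.1 * i.2)
  have hg (x : T) : ∃ z, j z = g x := by
    obtain ⟨z, hz⟩ := h x
    exact ⟨z, funext fun i => hz i.1 i.2⟩
  obtain ⟨Δ, hΔ⟩ := exists_comp_eq_of_injective (U := T ⊗[F] T) hj g hg
  exact ⟨Δ, fun x a b => congrFun (hΔ x) (a, b)⟩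

/-- The comultiplication of a representative space of functions, dual to the product. -/
def Representative.comul (h : Representative T) : T →ₗ[F] T ⊗[F] T := h.exists_comul.choose

theorem Representative.tensorFunctional_comul (h : Representative T) (x : T) (a b : M) :
    tensorFunctional (evalAt T a) (evalAt T b) (h.comul x) = x.1 (a * b) :=
  h.exists_comul.choose_spec x a b

theorem Representative.lift_comul (h : Representative T) (a b : M) :
    tensorFunctional (evalAt T a) (evalAt T b) ∘ₗ h.comul = evalAt T (a * b) :=
  LinearMap.ext fun x => h.tensorFunctional_comul x a b

/-- The coalgebra of a representative space of functions on a monoid. -/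
abbrev Representative.coalgebra (h : Representative T) : Coalgebra F T where
  comul := h.comul
  counit := evalAt T 1
  coassoc := by
    ext x
    refine ((separating_evalAt T).tensor
      ((separating_evalAt T).tensor (separating_evalAt T))).eq fun ⟨a, b, c⟩ => ?_
    -- At `(a, b, c)` the two iterated comultiplications give `x ((a * b) * c)` and `x (a * (b *
    -- c))`, so associativity of the monoid suffices.
    have h₁ : tensorFunctional (evalAt T a) (tensorFunctional (evalAt T b) (evalAt T c)) ∘ₗ
        (TensorProduct.assoc F T T T).toLinearMap ∘ₗ h.comul.rTensor T =
        tensorFunctional (evalAt T (a * b)) (evalAt T c) := by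
      rw [← h.lift_comul]
      refine TensorProduct.ext' fun y z => ?_
      simp only [LinearMap.comp_apply, LinearMap.rTensor_tmul, tensorFunctional_tmul]
      induction h.comul y with
      | zero => simp
      | tmul p q => simp [mul_assoc]
      | add p q hp hq => simp only [TensorProduct.add_tmul, map_add, hp, hq, add_mul]
    have h₂ : tensorFunctional (evalAt T a) (tensorFunctional (evalAt T b) (evalAt T c)) ∘ₗ
        h.comul.lTensor T = tensorFunctional (evalAt T a) (evalAt T (b * c)) := by
      rw [← h.lift_comul]
      exact TensorProduct.ext' fun y z => by simp
    have e₁ := LinearMap.congr_fun h₁ (h.comul x)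
    have e₂ := LinearMap.congr_fun h₂ (h.comul x)
    rw [h.tensorFunctional_comul, mul_assoc, ← h.tensorFunctional_comul] at e₁
    exact e₁.trans e₂.symm
  rTensor_counit_comp_comul := by
    refine LinearMap.ext fun x => (TensorProduct.lid F T).injective <|
      (separating_evalAt T).eq fun a => ?_
    have h₁ : evalAt T a ∘ₗ (TensorProduct.lid F T).toLinearMap ∘ₗ (evalAt T 1).rTensor T =
        tensorFunctional (evalAt T 1) (evalAt T a) := TensorProduct.ext' fun y z => by simp
    have e₁ := LinearMap.congr_fun h₁ (h.comul x)
    rw [h.tensorFunctional_comul, one_mul] at e₁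
    simpa using e₁
  lTensor_counit_comp_comul := by
    refine LinearMap.ext fun x => (TensorProduct.rid F T).injective <|
      (separating_evalAt T).eq fun a => ?_
    have h₁ : evalAt T a ∘ₗ (TensorProduct.rid F T).toLinearMap ∘ₗ (evalAt T 1).lTensor T =
        tensorFunctional (evalAt T a) (evalAt T 1) :=
      TensorProduct.ext' fun y z => by simp [mul_comm]
    have e₁ := LinearMap.congr_fun h₁ (h.comul x)
    rw [h.tensorFunctional_comul, mul_one] at e₁
    simpa using e₁

end Representative

/-! ### Word functions of a map out of a coalgebra -/

section WordEval

variable {F : Type u} [Field F] {W : Type v₁} [AddCommGroup W] [Module F W]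
  {P : Type*} [AddCommGroup P] [Module F P] [Coalgebra F P]
  {Q : Type*} [AddCommGroup Q] [Module F Q] [Coalgebra F Q]

/-- The convolution product of the functionals `φ ∘ f`, for `φ` running through a word. -/
def wordFunctional (f : P →ₗ[F] W) : FreeMonoid (Module.Dual F W) →* WithConv (P →ₗ[F] F) :=
  FreeMonoid.lift fun φ => toConv (φ ∘ₗ f)

/-- The map sending `p` to the function `φ₁ ⋯ φₙ ↦ φ₁ (f p₍₁₎) ⋯ φₙ (f p₍ₙ₎)` on words. -/
def wordEval (f : P →ₗ[F] W) :
    P →ₗ[F] (ULift.{w} (FreeMonoid (Module.Dual F W)) → F) :=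
  LinearMap.pi fun m => (wordFunctional f m.down).ofConv

theorem wordEval_one (f : P →ₗ[F] W) (p : P) : wordEval.{w} f p 1 = counit (R := F) p := by
  simp [wordEval]

theorem wordEval_of (f : P →ₗ[F] W) (p : P) (φ : Module.Dual F W) :
    wordEval.{w} f p ⟨FreeMonoid.of φ⟩ = φ (f p) := by
  simp [wordEval, wordFunctional]

theorem wordEval_mul (f : P →ₗ[F] W) (p : P) (a b : ULift.{w} (FreeMonoid (Module.Dual F W))) :
    wordEval f p (a * b) = tensorFunctional (LinearMap.proj a ∘ₗ wordEval f)
      (LinearMap.proj b ∘ₗ wordEval f) (comul (R := F) p) := by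
  change (wordFunctional f (a.down * b.down)).ofConv p = _
  rw [map_mul]
  rfl

/-- Precomposition with a coalgebra homomorphism respects convolution, so induction on the word
applies. -/
theorem wordFunctional_comp (f : Q →ₗ[F] W) (g : P →ₗc[F] Q) (m : FreeMonoid (Module.Dual F W)) :
    (wordFunctional (f ∘ₗ (g : P →ₗ[F] Q)) m).ofConv =
      (wordFunctional f m).ofConv ∘ₗ (g : P →ₗ[F] Q) := by
  induction m using FreeMonoid.inductionOn' with
  | one => ext p; simp
  | of_mul φ m ih =>
    rw [map_mul, map_mul]
    refine Eq.trans ?_ (LinearMap.convMul_comp_coalgHom_distrib _ _ g).symm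
    exact congrArg ofConv (congrArg₂ (· * ·) rfl (congrArg toConv ih))

theorem wordEval_comp (f : Q →ₗ[F] W) (g : P →ₗc[F] Q) (p : P) :
    wordEval.{w} (f ∘ₗ (g : P →ₗ[F] Q)) p = wordEval f (g p) :=
  funext fun m => LinearMap.congr_fun (wordFunctional_comp f g m.down) p

end WordEval

/-! ### Naturality of tensor powers in the coalgebra -/

section TensorPower

variable {F : Type u} [Field F] {P : Type*} [AddCommGroup P] [Module F P]
  {Q : Type*} [AddCommGroup Q] [Module F Q]
  {A : Type v₁} [AddCommGroup A] [Module F A] {B : Type v₂} [AddCommGroup B] [Module F B]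

theorem tensorCons_tmul_tprod (n : ℕ) (p : P) (x : Fin n → P) :
    tensorCons F P n (p ⊗ₜ PiTensorProduct.tprod F x) =
      PiTensorProduct.tprod F (Fin.cons p x : Fin (n + 1) → P) := by
  simp [tensorCons]

theorem map_comp_tensorCons (g : P →ₗ[F] Q) (n : ℕ) :
    PiTensorProduct.map (fun _ : Fin (n + 1) => g) ∘ₗ tensorCons F P n =
      tensorCons F Q n ∘ₗ TensorProduct.map g (PiTensorProduct.map fun _ : Fin n => g) := by
  ext p x
  simp only [LinearMap.compMultilinearMap_apply, TensorProduct.AlgebraTensorModule.curry_apply,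
    LinearMap.restrictScalars_self, TensorProduct.curry_apply, LinearMap.comp_apply,
    TensorProduct.map_tmul, PiTensorProduct.map_tprod, tensorCons_tmul_tprod]
  congr 1
  ext i
  refine Fin.cases ?_ (fun i => ?_) i <;> simp

theorem curry_comp_rTensor (ψ : Q ⊗[F] A →ₗ[F] B) (g : P →ₗ[F] Q) :
    TensorProduct.curry (ψ ∘ₗ g.rTensor A) = TensorProduct.curry ψ ∘ₗ g := by
  ext; simp

variable [Coalgebra F P] [Coalgebra F Q]

theorem iterComul_comp (g : P →ₗc[F] Q) (n : ℕ) :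
    iterComul F Q n ∘ₗ (g : P →ₗ[F] Q) =
      PiTensorProduct.map (fun _ : Fin n => (g : P →ₗ[F] Q)) ∘ₗ iterComul F P n := by
  induction n with
  | zero =>
    ext p
    simp [iterComul, PiTensorProduct.isEmptyEquiv,
      Subsingleton.elim (fun i => g (isEmptyElim i)) (isEmptyElim : Fin 0 → Q)]
  | succ n ih =>
    calc _ = tensorCons F Q n ∘ₗ (iterComul F Q n).lTensor Q ∘ₗ
          (comul ∘ₗ (g : P →ₗ[F] Q)) := rfl
      _ = tensorCons F Q n ∘ₗ TensorProduct.map (g : P →ₗ[F] Q)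
          (iterComul F Q n ∘ₗ (g : P →ₗ[F] Q)) ∘ₗ comul := by
        rw [← CoalgHomClass.map_comp_comul g, ← LinearMap.comp_assoc _ _ (LinearMap.lTensor _ _),
          LinearMap.lTensor_comp_map]
      _ = _ := by
        rw [ih, iterComul, ← LinearMap.comp_assoc _ (tensorCons F P n), map_comp_tensorCons,
          LinearMap.comp_assoc, ← LinearMap.comp_assoc comul (LinearMap.lTensor _ _),
          LinearMap.map_comp_lTensor]

theorem tensorPowerMap_comp (ψ : Q ⊗[F] A →ₗ[F] B) (g : P →ₗc[F] Q) (n : ℕ) (p : P) :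
    tensorPowerMap (ψ ∘ₗ (g : P →ₗ[F] Q).rTensor A) n p = tensorPowerMap ψ n (g p) := by
  have h := LinearMap.congr_fun (iterComul_comp g n) p
  simp only [LinearMap.comp_apply, LinearMap.coe_coe] at h
  simp only [tensorPowerMap, LinearMap.comp_apply, h, curry_comp_rTensor]
  rw [← LinearMap.comp_apply (PiTensorProduct.map _) (PiTensorProduct.map _),
    ← PiTensorProduct.map_comp]

variable (F P Q) in
/-- The left inclusion of coalgebras into their direct sum. -/
def inlCoalgHom : P →ₗc[F] P × Q where
  toLinearMap := LinearMap.inl F P Q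
  counit_comp := Prod.counit_comp_inl F P Q
  map_comp_comul := (Prod.comul_comp_inl F P Q).symm

variable (F P Q) in
/-- The right inclusion of coalgebras into their direct sum. -/
def inrCoalgHom : Q →ₗc[F] P × Q where
  toLinearMap := LinearMap.inr F P Q
  counit_comp := Prod.counit_comp_inr F P Q
  map_comp_comul := (Prod.comul_comp_inr F P Q).symm

end TensorPower

/-! ### Images and direct sums of measurings -/

namespace Meas

variable {F : Type u} [Field F] {Ω : Type z} {s t : Ω → ℕ}
  {A : Type v₁} [AddCommGroup A] [Module F A] [OmegaAlgebra F s t A]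
  {B : Type v₂} [AddCommGroup B] [Module F B] [OmegaAlgebra F s t B]
  {V : Submodule F (A →ₗ[F] B)}

/-- The measuring as a map `P → Hom(A, B)`. -/
def toHom (X : Meas.{w} s t A B V) : X.P →ₗ[F] A →ₗ[F] B := TensorProduct.curry X.ψ

theorem toHom_mem (X : Meas.{w} s t A B V) (p : X.P) : X.toHom p ∈ V :=
  X.cosupp_le ⟨p, rfl⟩

/-- Measurings are closed under sums of images of measurings. -/
theorem isMeasuring_of_forall_mem_span {Q : Type*} [AddCommGroup Q] [Module F Q] [Coalgebra F Q]
    (ψ : Q ⊗[F] A →ₗ[F] B)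
    (h : ∀ q : Q, q ∈ Submodule.span F {q |
      ∃ (X : Meas.{w} s t A B V) (g : X.P →ₗc[F] Q) (p : X.P),
      ψ ∘ₗ (g : X.P →ₗ[F] Q).rTensor A = X.ψ ∧ g p = q}) : IsMeasuring s t ψ := by
  intro ω q x
  induction h q using Submodule.span_induction with
  | mem q hq =>
    obtain ⟨X, g, p, hψ, rfl⟩ := hq
    -- By naturality, the identity at `g p` is the identity for `X` at `p`.
    rw [← tensorPowerMap_comp, ← tensorPowerMap_comp, hψ]
    exact X.isMeasuring ω p x
  | zero => simp
  | add q q' _ _ hq hq' => simp only [map_add, LinearMap.add_apply, hq, hq']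
  | smul c q _ hq => simp only [map_smul, LinearMap.smul_apply, hq]

/-- The zero coalgebra. -/
abbrev zeroCoalgebra : Coalgebra F PUnit.{w + 1} where
  comul := 0
  counit := 0
  coassoc := by ext; simp
  rTensor_counit_comp_comul := LinearMap.ext fun _ => Subsingleton.elim _ _
  lTensor_counit_comp_comul := LinearMap.ext fun _ => Subsingleton.elim _ _

variable (s t A B V) in
/-- The zero measuring. -/
def zero : Meas.{w} s t A B V :=
  letI : Coalgebra F PUnit.{w + 1} := zeroCoalgebra
  { P := CoalgCat.of F PUnit.{w + 1}
    ψ := 0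
    isMeasuring := fun ω p x => by
      rw [show p = 0 from Subsingleton.elim (α := PUnit) p 0]
      simp
    cosupp_le := by
      rintro _ ⟨p, rfl⟩
      exact V.zero_mem }

/-- The direct sum of two measurings. -/
def sum (X Y : Meas.{w} s t A B V) : Meas.{w} s t A B V where
  P := CoalgCat.of F (X.P × Y.P)
  ψ := TensorProduct.lift (X.toHom.coprod Y.toHom)
  isMeasuring := by
    refine isMeasuring_of_forall_mem_span (V := V) _ fun q => ?_
    rw [show q = inlCoalgHom F X.P Y.P q.1 + inrCoalgHom F X.P Y.P q.2 by
      simp [inlCoalgHom, inrCoalgHom]]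
    refine add_mem (Submodule.subset_span ⟨X, inlCoalgHom F X.P Y.P, q.1, ?_, rfl⟩)
      (Submodule.subset_span ⟨Y, inrCoalgHom F X.P Y.P, q.2, ?_, rfl⟩)
    · exact TensorProduct.ext' fun p a => by simp [inlCoalgHom, toHom]
    · exact TensorProduct.ext' fun p a => by simp [inrCoalgHom, toHom]
  cosupp_le := by
    rintro _ ⟨p, rfl⟩
    exact add_mem (X.toHom_mem p.1) (Y.toHom_mem p.2)

/-! ### The coalgebra of word functions of measurings -/

variable (s t A B V) in
/-- The functions on words in the functionals on `Hom(A, B)` which come from measurings. -/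
def wordFunctions : Submodule F (ULift.{w} (FreeMonoid (Module.Dual F (A →ₗ[F] B))) → F) where
  carrier := {x | ∃ (X : Meas.{w} s t A B V) (p : X.P), wordEval X.toHom p = x}
  zero_mem' := ⟨zero s t A B V, 0, map_zero _⟩
  add_mem' := by
    rintro _ _ ⟨X, p, rfl⟩ ⟨Y, q, rfl⟩
    refine ⟨X.sum Y, (p, q), ?_⟩
    let f := X.toHom.coprod Y.toHom
    have hX : X.toHom = f ∘ₗ (inlCoalgHom F X.P Y.P : X.P →ₗ[F] X.P × Y.P) :=
      (LinearMap.coprod_inl _ _).symm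
    have hY : Y.toHom = f ∘ₗ (inrCoalgHom F X.P Y.P : Y.P →ₗ[F] X.P × Y.P) :=
      (LinearMap.coprod_inr _ _).symm
    have hf : (X.sum Y).toHom = f := rfl
    rw [hX, hY, wordEval_comp, wordEval_comp, hf, ← map_add]
    exact congrArg (wordEval f) (by simp [inlCoalgHom, inrCoalgHom])
  smul_mem' := by
    rintro c _ ⟨X, p, rfl⟩
    exact ⟨X, c • p, map_smul _ _ _⟩

/-- The map from a measuring coalgebra to the space of word functions. -/
def toWordFunctions (X : Meas.{w} s t A B V) : X.P →ₗ[F] wordFunctions.{w} s t A B V :=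
  (wordEval X.toHom).codRestrict _ fun p => ⟨X, p, rfl⟩

theorem exists_toWordFunctions_eq (x : wordFunctions.{w} s t A B V) :
    ∃ (X : Meas.{w} s t A B V) (p : X.P), X.toWordFunctions p = x := by
  obtain ⟨X, p, h⟩ := x.2
  exact ⟨X, p, Subtype.ext h⟩

theorem tensorFunctional_toWordFunctions (X : Meas.{w} s t A B V) (p : X.P)
    (a b : ULift.{w} (FreeMonoid (Module.Dual F (A →ₗ[F] B)))) :
    tensorFunctional (evalAt _ a) (evalAt _ b)
      (TensorProduct.map X.toWordFunctions X.toWordFunctions (comul (R := F) p)) =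
      (X.toWordFunctions p).1 (a * b) := by
  refine Eq.trans ?_ (wordEval_mul X.toHom p a b).symm
  rw [← LinearMap.comp_apply, tensorFunctional, LinearMap.comp_assoc, ← TensorProduct.map_comp]
  rfl

theorem representative_wordFunctions : Representative (wordFunctions.{w} s t A B V) := by
  intro x
  obtain ⟨X, p, rfl⟩ := exists_toWordFunctions_eq x
  exact ⟨_, X.tensorFunctional_toWordFunctions p⟩

instance : Coalgebra F (wordFunctions.{w} s t A B V) := representative_wordFunctions.coalgebra

/-- The canonical coalgebra homomorphism to the coalgebra of word functions. -/
def toWordFunctionsHom (X : Meas.{w} s t A B V) : X.P →ₗc[F] wordFunctions.{w} s t A B V where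
  toLinearMap := X.toWordFunctions
  counit_comp := LinearMap.ext fun p => wordEval_one.{w} X.toHom p
  map_comp_comul := LinearMap.ext fun p =>
    ((separating_evalAt _).tensor (separating_evalAt _)).eq fun i =>
      (X.tensorFunctional_toWordFunctions p i.1 i.2).trans
        (representative_wordFunctions.tensorFunctional_comul _ _ _).symm

/-- The values on one-letter words are all the functionals of `X.toHom p`; these determine it, so
the result does not depend on the choice of `X` and `p`. -/
theorem exists_wordFunctions_toHom :
    ∃ k : wordFunctions.{w} s t A B V →ₗ[F] A →ₗ[F] B,
      ∀ X : Meas.{w} s t A B V, ∀ p, k (X.toWordFunctions p) = X.toHom p := by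
  obtain ⟨k, hk⟩ := exists_comp_eq_of_injective
    (separating_id_dual (F := F) (U := A →ₗ[F] B)).pi_injective
    (N := wordFunctions.{w} s t A B V)
    (LinearMap.pi fun φ => evalAt (wordFunctions.{w} s t A B V) ⟨FreeMonoid.of φ⟩)
    fun x => by
      obtain ⟨X, p, rfl⟩ := exists_toWordFunctions_eq x
      exact ⟨X.toHom p, funext fun φ => (wordEval_of.{w} X.toHom p φ).symm⟩
  refine ⟨k, fun X p => (separating_id_dual (F := F)).eq fun φ => ?_⟩
  exact (congrFun (hk _) φ).trans (wordEval_of.{w} X.toHom p φ)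

variable (s t A B V) in
/-- The universal measuring, as a map from the coalgebra of word functions to `Hom(A, B)`. -/
def wordFunctionsToHom : wordFunctions.{w} s t A B V →ₗ[F] A →ₗ[F] B :=
  exists_wordFunctions_toHom.choose

theorem wordFunctionsToHom_apply (X : Meas.{w} s t A B V) (p : X.P) :
    wordFunctionsToHom s t A B V (X.toWordFunctions p) = X.toHom p :=
  exists_wordFunctions_toHom.choose_spec X p

theorem lift_comp_toWordFunctionsHom (X : Meas.{w} s t A B V) :
    TensorProduct.lift (wordFunctionsToHom s t A B V) ∘ₗ
      (X.toWordFunctionsHom : X.P →ₗ[F] _).rTensor A = X.ψ :=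
  TensorProduct.ext' fun p a => LinearMap.congr_fun (X.wordFunctionsToHom_apply p) a

variable (s t A B V) in
-- The terminal object
/-- The universal measuring with cosupport in `V`. -/
def universal : Meas.{max w u v₁ v₂} s t A B V where
  P := CoalgCat.of F (wordFunctions.{max w u v₁ v₂} s t A B V)
  ψ := TensorProduct.lift (wordFunctionsToHom s t A B V)
  isMeasuring := by
    refine isMeasuring_of_forall_mem_span (V := V) _ fun x => ?_
    obtain ⟨X, p, rfl⟩ := exists_toWordFunctions_eq x
    exact Submodule.subset_span
      ⟨X, X.toWordFunctionsHom, p, X.lift_comp_toWordFunctionsHom, rfl⟩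
  cosupp_le := by
    rintro _ ⟨x, rfl⟩
    obtain ⟨X, p, rfl⟩ := exists_toWordFunctions_eq x
    have h := X.toHom_mem p
    rwa [← X.wordFunctionsToHom_apply p] at h

/-- Naturality along `X.toWordFunctionsHom` reduces this to the word function of `X` that defines
`x`. It is the source of uniqueness. -/
theorem wordEval_wordFunctionsToHom (x : wordFunctions.{w} s t A B V) :
    wordEval (wordFunctionsToHom s t A B V) x = x.1 := by
  obtain ⟨X, p, rfl⟩ := exists_toWordFunctions_eq x
  have h : wordFunctionsToHom s t A B V ∘ₗ (X.toWordFunctionsHom : X.P →ₗ[F] _) = X.toHom :=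
    LinearMap.ext X.wordFunctionsToHom_apply
  refine (wordEval_comp _ X.toWordFunctionsHom p).symm.trans ?_
  rw [h]
  rfl

variable (s t A B V) in
/-- The universal measuring is terminal. -/
def isTerminalUniversal :
    CategoryTheory.Limits.IsTerminal (universal.{w} s t A B V) :=
  CategoryTheory.Limits.IsTerminal.ofUniqueHom
    (fun X => (⟨X.toWordFunctionsHom, X.lift_comp_toWordFunctionsHom⟩ : Hom X _))
    fun X m => by
      refine Hom.ext (DFunLike.ext _ _ fun p => Subtype.ext ?_)
      let g : X.P →ₗc[F] wordFunctions.{max w u v₁ v₂} s t A B V := m.φ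
      have h : wordFunctionsToHom s t A B V ∘ₗ (g : X.P →ₗ[F] _) = X.toHom := by
        rw [toHom, ← m.comm]
        rfl
      -- `g p` is its own word function, which by naturality is that of `X` at `p`, whatever `g` is.
      refine (wordEval_wordFunctionsToHom (g p)).symm.trans ?_
      refine (wordEval_comp (wordFunctionsToHom s t A B V) g p).symm.trans ?_
      rw [h]
      rfl

end Meas

end OmegaAlg

end

theorem mainTheorem7 {F : Type u} [Field F] {Ω : Type z} (s t : Ω → ℕ)
    (A : Type v₁) [AddCommGroup A] [Module F A] [OmegaAlg.OmegaAlgebra F s t A]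
    (B : Type v₂) [AddCommGroup B] [Module F B] [OmegaAlg.OmegaAlgebra F s t B]
    (V : Submodule F (A →ₗ[F] B)) :
    ∃ T : OmegaAlg.Meas.{max w u v₁ v₂} s t A B V,
      Nonempty (CategoryTheory.Limits.IsTerminal T) :=
  ⟨OmegaAlg.Meas.universal.{w} s t A B V, ⟨OmegaAlg.Meas.isTerminalUniversal.{w} s t A B V⟩⟩
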